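/- Let $N\in\mathbb N$ and $1<p<N$, let $\Omega\subset\mathbb R^N$ be open and bounded, and let $f\in L^m(\Omega)$ for some $m\ge 1$, with $f\ge 0$ a.e. in $\Omega$. Let $h:[0,\infty)\to[0,\infty]$ be continuous, non-increasing, finite on $(0,\infty)$, with $h(0)\neq 0$ (the value $h(0)=\infty$ is allowed), and let $g:[0,\infty)\to[0,\infty)$ be continuous and non-decreasing with $g(0)=0$. Consider the problem $$-\Delta_p u+g(u)=h(u)f\ \text{ in }\Omega,\qquad u=0\ \text{ on }\partial\Omega,\qquad \Delta_p u=\operatorname{div}(|\nabla u|^{p-2}\nabla u).\tag{P}$$ A solution of (P) is a function $u\in W^{1,1}_0(\Omega)$ with $u\ge 0$ a.e. in $\Omega$ such that $|\nabla u|^{p-1}\in L^1(\Omega)$, $g(u)\in L^1_{\rm loc}(\Omega)$, $h(u)f\in L^1_{\rm loc}(\Omega)$ (with the convention $\infty\cdot 0=0$ in the product $h(u)f$), and $$\int_\Omega|\nabla u|^{p-2}\nabla u\cdot\nabla\varphi+\int_\Omega g(u)\varphi=\int_\Omega h(u)f\varphi\qquad\text{for all }\varphi\in C^1_c(\Omega).$$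 Here $W^{1,q}_0(\Omega)$ is the closure of $C^\infty_c(\Omega)$ in $W^{1,q}(\Omega)$. Then there is at most one solution $u$ of (P) with $u\in W^{1,p}_0(\Omega)$ and $g(u)\in L^1(\Omega)$: any two such solutions are equal a.e. in $\Omega$. -/

import Mathlib

open MeasureTheory Set Filter Topology
open scoped NNReal ENNReal ContDiff

/-- `G` is the weak (distributional) gradient of `u` in the open set `Ω`:
`∫_Ω u ∇φ = - ∫_Ω φ G` for every `φ ∈ C^∞_c(Ω)`. -/
structure IsWeakGradient {N : ℕ} (Ω : Set (EuclideanSpace ℝ (Fin N)))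
    (u : EuclideanSpace ℝ (Fin N) → ℝ)
    (G : EuclideanSpace ℝ (Fin N) → EuclideanSpace ℝ (Fin N)) : Prop where
  locallyIntegrable : LocallyIntegrableOn u Ω volume
  locallyIntegrable_grad : LocallyIntegrableOn G Ω volume
  integral_eq : ∀ φ : EuclideanSpace ℝ (Fin N) → ℝ,
    ContDiff ℝ ∞ φ → HasCompactSupport φ → tsupport φ ⊆ Ω →
      ∫ x in Ω, u x • gradient φ x = - ∫ x in Ω, φ x • G x

/-- `u ∈ W^{1,q}_0(Ω)`: `u ∈ L^q(Ω)` has a weak gradient `G ∈ L^q(Ω)`, and `u` lies in the closure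
of `C^∞_c(Ω)` for the norm of `W^{1,q}(Ω)`. -/
def MemW1Zero {N : ℕ} (q : ℝ≥0∞) (Ω : Set (EuclideanSpace ℝ (Fin N)))
    (u : EuclideanSpace ℝ (Fin N) → ℝ) : Prop :=
  ∃ G : EuclideanSpace ℝ (Fin N) → EuclideanSpace ℝ (Fin N),
    IsWeakGradient Ω u G ∧
    MemLp u q (volume.restrict Ω) ∧
    MemLp G q (volume.restrict Ω) ∧
    ∃ φ : ℕ → EuclideanSpace ℝ (Fin N) → ℝ,
      (∀ n, ContDiff ℝ ∞ (φ n) ∧ HasCompactSupport (φ n) ∧ tsupport (φ n) ⊆ Ω) ∧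
      Tendsto (fun n => eLpNorm (fun x => φ n x - u x) q (volume.restrict Ω)) atTop (𝓝 0) ∧
      Tendsto (fun n => eLpNorm (fun x => gradient (φ n) x - G x) q (volume.restrict Ω))
        atTop (𝓝 0)

/-- The function `h(u) f` with values in `[0,∞]`, for `u, f ≥ 0`. Here `h` may be infinite at `0`;
the product follows the convention `∞ · 0 = 0`. -/
noncomputable def singularTerm {N : ℕ} (h : ℝ≥0 → ℝ≥0∞) (f u : EuclideanSpace ℝ (Fin N) → ℝ)
    (x : EuclideanSpace ℝ (Fin N)) : ℝ≥0∞ :=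
  h (u x).toNNReal * ENNReal.ofReal (f x)

/-- `u` is a (distributional) solution, for `1 < p < N`, of
`-Δ_p u + g(u) = h(u) f` in `Ω`, `u = 0` on `∂Ω`: a nonnegative `u ∈ W^{1,1}_0(Ω)` with
`|∇u|^{p-1} ∈ L^1(Ω)`, with `g(u), h(u) f ∈ L^1_loc(Ω)`, and with
`∫_Ω |∇u|^{p-2} ∇u · ∇φ + ∫_Ω g(u) φ = ∫_Ω h(u) f φ` for all `φ ∈ C^1_c(Ω)`. -/
structure IsDistributionalSolution {N : ℕ} (p : ℝ) (Ω : Set (EuclideanSpace ℝ (Fin N)))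
    (g : ℝ≥0 → ℝ≥0) (h : ℝ≥0 → ℝ≥0∞) (f u : EuclideanSpace ℝ (Fin N) → ℝ) : Prop where
  nonneg : ∀ᵐ x ∂(volume.restrict Ω), 0 ≤ u x
  memW1Zero : MemW1Zero 1 Ω u
  absorption_locallyIntegrable :
    LocallyIntegrableOn (fun x => (g (u x).toNNReal : ℝ)) Ω volume
  singular_locallyIntegrable :
    ∀ K : Set (EuclideanSpace ℝ (Fin N)), IsCompact K → K ⊆ Ω →
      ∫⁻ x in K, singularTerm h f u x < ⊤
  weak_formulation :
    ∃ G : EuclideanSpace ℝ (Fin N) → EuclideanSpace ℝ (Fin N),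
      IsWeakGradient Ω u G ∧
      IntegrableOn (fun x => ‖G x‖ ^ (p - 1)) Ω volume ∧
      ∀ φ : EuclideanSpace ℝ (Fin N) → ℝ,
        ContDiff ℝ 1 φ → HasCompactSupport φ → tsupport φ ⊆ Ω →
          (∫ x in Ω, inner ℝ (‖G x‖ ^ (p - 2) • G x) (gradient φ x))
            + ∫ x in Ω, (g (u x).toNNReal : ℝ) * φ x
          = ∫ x in Ω, (singularTerm h f u x).toReal * φ x

/-!
Let `u₁` and `u₂` be two solutions in `W^{1,p}_0(Ω)`, and put `w = u₁ - u₂`. Were `S(w)` an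
admissible test function for some bounded `S ≥ 0` with `S = 0` on `(-∞, 0]` and `S' > 0` on `(0,
∞)`, the difference of the two equations would give
`∫ (|∇u₁|^{p-2} ∇u₁ - |∇u₂|^{p-2} ∇u₂) · ∇w S'(w) + ∫ (g(u₁) - g(u₂)) S(w)
  = ∫ (h(u₁) - h(u₂)) f S(w) ≤ 0`.
On the left both integrands are nonnegative, so by strict monotonicity of `ξ ↦ |ξ|^{p-2} ξ`
(`inner_rpow_smul_sub_pos`) the gradient of `w` vanishes where `w > 0`, and the
Gagliardo-Nirenberg-Sobolev inequality gives `w ≤ 0` (`ae_nonpos_of_gradient_eq_zero`). Exchanging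
`u₁` and `u₂` gives equality.

The difficulty is that `h(u) f` is only locally integrable, so that `S(w)`, which need not have
compact support, is not directly a test function. Take `S = s²` with `s = ramp`, which is bounded,
of class `C¹`, and zero on `(-∞, 0]`, and let `φ n ∈ C^∞_c(Ω)` converge to `w` in `W^{1,p}` and
almost everywhere. Then `s(φ n) s(φ k)` is a legitimate test function. Letting `k → ∞` with `n`
fixed, the supports stay in that of `φ n`, and dominated convergence applies to the singular term.
The limit `s(φ n) s(w)` is supported where `w > 0`, so the right-hand side is nonpositive for
every `n`. It may now be dropped, and only the left-hand side, which is controlled on all of `Ω`,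
has to pass to the limit `n → ∞` (`energy_inequality`).
-/

/-! ### A bounded C¹ replacement for the positive part -/

/-- The function `t ↦ (t⁺)² / (1 + (t⁺)²)`: it vanishes on `(-∞, 0]`, and is bounded, of class `C¹`
and strictly increasing on `[0, ∞)`. -/
noncomputable def ramp (t : ℝ) : ℝ := max t 0 ^ 2 / (1 + max t 0 ^ 2)

/-- The derivative of `ramp`. -/
noncomputable def rampDeriv (t : ℝ) : ℝ := 2 * max t 0 / (1 + max t 0 ^ 2) ^ 2

lemma ramp_nonneg (t : ℝ) : 0 ≤ ramp t := by unfold ramp; positivity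

lemma ramp_le_one (t : ℝ) : ramp t ≤ 1 := by
  unfold ramp
  rw [div_le_one (by positivity)]
  linarith

lemma ramp_of_nonpos {t : ℝ} (ht : t ≤ 0) : ramp t = 0 := by simp [ramp, ht]

lemma ramp_pos {t : ℝ} (ht : 0 < t) : 0 < ramp t := by
  unfold ramp
  rw [max_eq_left ht.le]
  positivity

lemma rampDeriv_nonneg (t : ℝ) : 0 ≤ rampDeriv t := by unfold rampDeriv; positivity

lemma rampDeriv_pos {t : ℝ} (ht : 0 < t) : 0 < rampDeriv t := by
  unfold rampDeriv
  rw [max_eq_left ht.le]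
  positivity

lemma rampDeriv_le_one (t : ℝ) : rampDeriv t ≤ 1 := by
  unfold rampDeriv
  rw [div_le_one (by positivity)]
  nlinarith [sq_nonneg (max t 0 - 1), sq_nonneg (max t 0 ^ 2)]

lemma abs_ramp_le (t : ℝ) : |ramp t| ≤ 1 := by
  rw [abs_of_nonneg (ramp_nonneg t)]; exact ramp_le_one t

lemma abs_rampDeriv_le (t : ℝ) : |rampDeriv t| ≤ 1 := by
  rw [abs_of_nonneg (rampDeriv_nonneg t)]; exact rampDeriv_le_one t

lemma continuous_ramp : Continuous ramp := by
  unfold ramp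
  exact Continuous.div (by fun_prop) (by fun_prop) fun t => by positivity

lemma continuous_rampDeriv : Continuous rampDeriv := by
  unfold rampDeriv
  exact Continuous.div (by fun_prop) (by fun_prop) fun t => by positivity

lemma hasDerivAt_max_zero_sq (t : ℝ) : HasDerivAt (fun t : ℝ => max t 0 ^ 2) (2 * max t 0) t := by
  rcases lt_trichotomy t 0 with ht | rfl | ht
  · have h : (fun t : ℝ => max t 0 ^ 2) =ᶠ[𝓝 t] fun _ => 0 := by
      filter_upwards [Iio_mem_nhds ht] with y hy
      simp [le_of_lt (show y < 0 from hy)]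
    rw [max_eq_right ht.le, mul_zero]
    exact (hasDerivAt_const t (0 : ℝ)).congr_of_eventuallyEq h
  · rw [hasDerivAt_iff_isLittleO_nhds_zero]
    have h : (fun y : ℝ => max (0 + y) 0 ^ 2 - max (0 : ℝ) 0 ^ 2 - y • (2 * max (0 : ℝ) 0))
        =O[𝓝 0] fun y : ℝ => y ^ 2 := by
      refine Asymptotics.IsBigO.of_bound 1 (Eventually.of_forall fun y => ?_)
      rcases le_total y 0 with hy | hy <;> simp [hy, sq_nonneg]
    exact h.trans_isLittleO (Asymptotics.isLittleO_pow_id one_lt_two)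
  · have h : (fun t : ℝ => max t 0 ^ 2) =ᶠ[𝓝 t] fun t => t ^ 2 := by
      filter_upwards [Ioi_mem_nhds ht] with y hy
      simp [le_of_lt (show 0 < y from hy)]
    rw [max_eq_left ht.le]
    simpa using (hasDerivAt_pow 2 t).congr_of_eventuallyEq h

lemma hasDerivAt_ramp (t : ℝ) : HasDerivAt ramp (rampDeriv t) t := by
  have h := (hasDerivAt_max_zero_sq t).div ((hasDerivAt_max_zero_sq t).const_add 1)
    (by positivity)
  convert! h using 1
  unfold rampDeriv
  congr 1
  ring

lemma contDiff_ramp : ContDiff ℝ 1 ramp := by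
  rw [contDiff_one_iff_deriv]
  refine ⟨fun t => (hasDerivAt_ramp t).differentiableAt, ?_⟩
  rw [show deriv ramp = rampDeriv from funext fun t => (hasDerivAt_ramp t).deriv]
  exact continuous_rampDeriv

lemma gradient_ramp_mul_ramp {F : Type*} [NormedAddCommGroup F] [InnerProductSpace ℝ F]
    [CompleteSpace F] {φ ψ : F → ℝ} (hφ : Differentiable ℝ φ) (hψ : Differentiable ℝ ψ) (x : F) :
    gradient (fun y => ramp (φ y) * ramp (ψ y)) x =
      (rampDeriv (φ x) * ramp (ψ x)) • gradient φ x
        + (ramp (φ x) * rampDeriv (ψ x)) • gradient ψ x := by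
  apply HasGradientAt.gradient
  have h1 := (hasDerivAt_ramp (φ x)).comp_hasFDerivAt x (hφ x).hasGradientAt.hasFDerivAt
  have h2 := (hasDerivAt_ramp (ψ x)).comp_hasFDerivAt x (hψ x).hasGradientAt.hasFDerivAt
  rw [hasGradientAt_iff_hasFDerivAt]
  convert! h1.mul h2 using 1
  simp only [map_add, map_smul, smul_smul, Function.comp]
  rw [add_comm, mul_comm (ramp (ψ x))]

lemma contDiff_ramp_mul_ramp {F : Type*} [NormedAddCommGroup F] [NormedSpace ℝ F] {φ ψ : F → ℝ}
    (hφ : ContDiff ℝ 1 φ) (hψ : ContDiff ℝ 1 ψ) :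
    ContDiff ℝ 1 (fun y => ramp (φ y) * ramp (ψ y)) :=
  (contDiff_ramp.comp hφ).mul (contDiff_ramp.comp hψ)

lemma tsupport_ramp_mul_ramp_subset {F : Type*} [TopologicalSpace F] (φ ψ : F → ℝ) :
    tsupport (fun y => ramp (φ y) * ramp (ψ y)) ⊆ tsupport φ := by
  refine closure_mono fun y hy => ?_
  contrapose! hy
  simp only [Function.mem_support, not_not] at hy ⊢
  simp [hy, ramp]

/-! ### The vector field of the p-Laplacian -/

lemma inner_rpow_smul_sub_pos {F : Type*} [NormedAddCommGroup F] [InnerProductSpace ℝ F]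
    {p : ℝ} (hp : 1 < p) {x y : F} (hxy : x ≠ y) :
    0 < inner ℝ (‖x‖ ^ (p - 2) • x - ‖y‖ ^ (p - 2) • y) (x - y) := by
  have key : ∀ z : F, z ≠ 0 → 0 < ‖z‖ ^ (p - 2) * ‖z‖ ^ 2 := fun z hz => by positivity
  rcases eq_or_ne x 0 with rfl | hx
  · have := key y hxy.symm
    simpa [inner_smul_left] using this
  rcases eq_or_ne y 0 with rfl | hy
  · have := key x hxy
    simpa [inner_smul_left] using this
  have hx' : 0 < ‖x‖ := by positivity
  have hy' : 0 < ‖y‖ := by positivity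
  have hexp : inner ℝ (‖x‖ ^ (p - 2) • x - ‖y‖ ^ (p - 2) • y) (x - y) =
      (‖x‖ ^ (p - 1) - ‖y‖ ^ (p - 1)) * (‖x‖ - ‖y‖)
        + (‖x‖ ^ (p - 2) + ‖y‖ ^ (p - 2)) * (‖x‖ * ‖y‖ - inner ℝ x y) := by
    have e1 : ‖x‖ ^ (p - 1) = ‖x‖ ^ (p - 2) * ‖x‖ := by
      rw [← Real.rpow_add_one hx'.ne']; ring_nf
    have e2 : ‖y‖ ^ (p - 1) = ‖y‖ ^ (p - 2) * ‖y‖ := by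
      rw [← Real.rpow_add_one hy'.ne']; ring_nf
    simp only [inner_sub_left, inner_sub_right, inner_smul_left, real_inner_self_eq_norm_sq,
      real_inner_comm x y, e1, e2, conj_trivial]
    ring
  have hcs : 0 ≤ ‖x‖ * ‖y‖ - inner ℝ x y := sub_nonneg.2 (real_inner_le_norm x y)
  have hsum : 0 < ‖x‖ ^ (p - 2) + ‖y‖ ^ (p - 2) := by positivity
  rw [hexp]
  rcases lt_trichotomy ‖x‖ ‖y‖ with hlt | heq | hlt
  · have := Real.rpow_lt_rpow hx'.le hlt (show 0 < p - 1 by linarith)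
    have h1 := mul_pos_of_neg_of_neg (sub_neg.2 this) (sub_neg.2 hlt)
    have h2 := mul_nonneg hsum.le hcs
    linarith
  · have hne : inner ℝ x y ≠ ‖x‖ * ‖y‖ := fun hc => by
      rw [inner_eq_norm_mul_iff_real, heq] at hc
      exact hxy (smul_right_injective F hy'.ne' hc)
    have h2 := mul_pos hsum (lt_of_le_of_ne hcs fun h => hne (by linarith))
    rw [heq] at h2 ⊢
    simpa using h2
  · have := Real.rpow_lt_rpow hy'.le hlt (show 0 < p - 1 by linarith)
    have h1 := mul_pos (sub_pos.2 this) (sub_pos.2 hlt)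
    have h2 := mul_nonneg hsum.le hcs
    linarith

lemma inner_rpow_smul_sub_nonneg {F : Type*} [NormedAddCommGroup F] [InnerProductSpace ℝ F]
    {p : ℝ} (hp : 1 < p) (x y : F) :
    0 ≤ inner ℝ (‖x‖ ^ (p - 2) • x - ‖y‖ ^ (p - 2) • y) (x - y) := by
  rcases eq_or_ne x y with rfl | hxy
  · simp
  · exact (inner_rpow_smul_sub_pos hp hxy).le

section Lp

variable {α : Type*} [MeasurableSpace α] {μ : Measure α}
  {F : Type*} [NormedAddCommGroup F] [InnerProductSpace ℝ F]

lemma MeasureTheory.MemLp.rpow_norm_smul {p : ℝ} (hp : 1 < p) {G : α → F}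
    (hG : MemLp G (ENNReal.ofReal p) μ) :
    MemLp (fun x => ‖G x‖ ^ (p - 2) • G x) (ENNReal.ofReal (p / (p - 1))) μ := by
  have hp1 : 0 < p - 1 := by linarith
  have h := hG.norm_rpow_div (ENNReal.ofReal (p - 1))
  rw [ENNReal.toReal_ofReal hp1.le, ← ENNReal.ofReal_div_of_pos hp1] at h
  have hm : AEStronglyMeasurable (fun x => ‖G x‖ ^ (p - 2) • G x) μ :=
    ((hG.1.norm.aemeasurable.pow_const (p - 2)).aestronglyMeasurable).smul hG.1
  refine h.mono hm (Eventually.of_forall fun x => ?_)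
  rcases eq_or_ne (G x) 0 with h0 | h0
  · simp [h0, Real.zero_rpow hp1.ne']
  · have hpos : 0 < ‖G x‖ := norm_pos_iff.2 h0
    have e : p - 1 = (p - 2) + 1 := by ring
    rw [norm_smul, Real.norm_of_nonneg (by positivity), Real.norm_of_nonneg (by positivity), e,
      Real.rpow_add_one hpos.ne']

/-! ### Passing to the limit -/

lemma eLpNorm_inner_smul_le {p q : ℝ≥0∞} [ENNReal.HolderTriple q p 1] {A g : α → F} {a : α → ℝ}
    (hA : AEStronglyMeasurable A μ) (hg : AEStronglyMeasurable g μ)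
    (hC : ∀ x, |a x| ≤ 1) :
    eLpNorm (fun x => inner ℝ (A x) (a x • g x)) 1 μ ≤ eLpNorm A q μ * eLpNorm g p μ := by
  calc eLpNorm (fun x => inner ℝ (A x) (a x • g x)) 1 μ
      ≤ eLpNorm (fun x => ‖A x‖ * ‖g x‖) 1 μ := by
        refine eLpNorm_mono fun x => ?_
        rw [Real.norm_of_nonneg (by positivity : 0 ≤ ‖A x‖ * ‖g x‖)]
        refine (norm_inner_le_norm _ _).trans ?_
        rw [norm_smul, Real.norm_eq_abs]
        gcongr
        exact mul_le_of_le_one_left (norm_nonneg _) (hC x)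
    _ ≤ (1 : ℝ≥0) * eLpNorm (fun x => ‖A x‖) q μ * eLpNorm (fun x => ‖g x‖) p μ :=
        eLpNorm_le_eLpNorm_mul_eLpNorm_of_nnnorm hA.norm hg.norm (· * ·) 1
          (Eventually.of_forall fun x => by simp)
    _ = eLpNorm A q μ * eLpNorm g p μ := by simp

lemma integrable_inner_smul {p q : ℝ≥0∞} [ENNReal.HolderTriple q p 1] {A g : α → F} {a : α → ℝ}
    (hA : MemLp A q μ) (hg : MemLp g p μ) (ha : AEStronglyMeasurable a μ)
    (hC : ∀ x, |a x| ≤ 1) :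
    Integrable (fun x => inner ℝ (A x) (a x • g x)) μ := by
  rw [← memLp_one_iff_integrable]
  exact ⟨hA.1.inner (ha.smul hg.1),
    (eLpNorm_inner_smul_le hA.1 hg.1 hC).trans_lt (ENNReal.mul_lt_top hA.2 hg.2)⟩

/-- Bounded almost everywhere convergence of the scalar factor and `L^p` convergence of the vector
factor suffice to pass to the limit against a fixed field in the dual space. -/
lemma tendsto_integral_inner_smul {p q : ℝ≥0∞} [ENNReal.HolderTriple q p 1]
    {A g : α → F} {G : ℕ → α → F} {a : ℕ → α → ℝ} {b : α → ℝ}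
    (hA : MemLp A q μ) (hg : MemLp g p μ) (hG : ∀ k, MemLp (G k) p μ)
    (ha : ∀ k, AEStronglyMeasurable (a k) μ) (hC : ∀ k x, |a k x| ≤ 1)
    (hab : ∀ᵐ x ∂μ, Tendsto (fun k => a k x) atTop (𝓝 (b x)))
    (hlim : Tendsto (fun k => eLpNorm (fun x => G k x - g x) p μ) atTop (𝓝 0)) :
    Tendsto (fun k => ∫ x, inner ℝ (A x) (a k x • G k x) ∂μ) atTop
      (𝓝 (∫ x, inner ℝ (A x) (b x • g x) ∂μ)) := by
  have hsub : ∀ k, MemLp (fun x => G k x - g x) p μ := fun k => (hG k).sub hg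
  have hsplit : ∀ k, ∫ x, inner ℝ (A x) (a k x • G k x) ∂μ =
      ∫ x, inner ℝ (A x) (a k x • (G k x - g x)) ∂μ + ∫ x, inner ℝ (A x) (a k x • g x) ∂μ := by
    intro k
    rw [← integral_add
      (integrable_inner_smul hA (hsub k) (ha k) (hC k))
      (integrable_inner_smul hA hg (ha k) (hC k))]
    refine integral_congr_ae (Eventually.of_forall fun x => ?_)
    simp only [← inner_add_right, ← smul_add, sub_add_cancel]
  have h1 : Tendsto (fun k => ∫ x, inner ℝ (A x) (a k x • (G k x - g x)) ∂μ) atTop (𝓝 0) := by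
    have hz : Tendsto (fun k => eLpNorm A q μ * eLpNorm (fun x => G k x - g x) p μ) atTop
        (𝓝 0) := by
      simpa using ENNReal.Tendsto.const_mul hlim (Or.inr hA.2.ne)
    have hz' := (tendsto_of_tendsto_of_tendsto_of_le_of_le tendsto_const_nhds hz
      (fun _ => zero_le) fun k =>
        eLpNorm_inner_smul_le hA.1 (hsub k).1 (hC k))
    have hzero : (0 : ℝ) = ∫ _x, (0 : ℝ) ∂μ := by simp
    rw [hzero]
    refine tendsto_integral_of_L1' _ (integrable_zero _ _ _).aestronglyMeasurable
      (Eventually.of_forall fun k =>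
      integrable_inner_smul hA (hsub k) (ha k) (hC k)) ?_
    convert! hz' using 2 with k
    simp
  have h2 : Tendsto (fun k => ∫ x, inner ℝ (A x) (a k x • g x) ∂μ) atTop
      (𝓝 (∫ x, inner ℝ (A x) (b x • g x) ∂μ)) := by
    have hdom : Integrable (fun x => ‖inner ℝ (‖A x‖) ((1 : ℝ) • ‖g x‖)‖) μ :=
      (integrable_inner_smul (a := fun _ => 1) hA.norm hg.norm aestronglyMeasurable_const
        (by simp)).norm
    refine tendsto_integral_of_dominated_convergence _
      (fun k => (integrable_inner_smul hA hg (ha k) (hC k)).1) hdom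
      (fun k => Eventually.of_forall fun x => ?_) ?_
    · refine (norm_inner_le_norm _ _).trans ?_
      rw [norm_smul, Real.norm_eq_abs]
      have : |a k x| * ‖g x‖ ≤ ‖g x‖ := mul_le_of_le_one_left (norm_nonneg _) (hC k x)
      have := mul_le_mul_of_nonneg_left this (norm_nonneg (A x))
      simpa [abs_mul, mul_comm] using this
    · filter_upwards [hab] with x hx
      exact tendsto_const_nhds.inner (hx.smul_const (g x))
  simpa [hsplit] using h1.add h2

/-- Dominated convergence for a fixed integrable weight. -/
lemma tendsto_integral_mul_of_abs_le_one {c : α → ℝ} {a : ℕ → α → ℝ} {b : α → ℝ}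
    (hc : Integrable c μ) (ha : ∀ k, AEStronglyMeasurable (a k) μ) (hC : ∀ k x, |a k x| ≤ 1)
    (hab : ∀ᵐ x ∂μ, Tendsto (fun k => a k x) atTop (𝓝 (b x))) :
    Tendsto (fun k => ∫ x, c x * a k x ∂μ) atTop (𝓝 (∫ x, c x * b x ∂μ)) := by
  refine tendsto_integral_of_dominated_convergence _ (fun k => hc.1.mul (ha k)) hc.norm
    (fun k => Eventually.of_forall fun x => ?_) ?_
  · rw [norm_mul]
    exact mul_le_of_le_one_right (norm_nonneg _) (hC k x)
  · filter_upwards [hab] with x hx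
    exact hx.const_mul _

end Lp

/-! ### The energy inequality and the vanishing of the positive part -/

section Energy

variable {N : ℕ} {Ω : Set (EuclideanSpace ℝ (Fin N))} {w : EuclideanSpace ℝ (Fin N) → ℝ}
  {G : EuclideanSpace ℝ (Fin N) → EuclideanSpace ℝ (Fin N)}
  {φ : ℕ → EuclideanSpace ℝ (Fin N) → ℝ}

lemma ContDiff.continuous_gradient {φ : EuclideanSpace ℝ (Fin N) → ℝ} (hφ : ContDiff ℝ 1 φ) :
    Continuous (gradient φ) :=
  (InnerProductSpace.toDual ℝ (EuclideanSpace ℝ (Fin N))).symm.continuous.comp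
    (hφ.continuous_fderiv one_ne_zero)

lemma support_gradient_subset (φ : EuclideanSpace ℝ (Fin N) → ℝ) :
    Function.support (gradient φ) ⊆ tsupport φ := by
  intro x hx
  refine support_fderiv_subset ℝ (f := φ) fun h => hx ?_
  simp [gradient, h]

lemma ContDiff.memLp_gradient {φ : EuclideanSpace ℝ (Fin N) → ℝ} (hφ : ContDiff ℝ 1 φ)
    (hc : HasCompactSupport φ) (p : ℝ≥0∞) : MemLp (gradient φ) p (volume.restrict Ω) :=
  (hφ.continuous_gradient.memLp_of_hasCompactSupport
    (HasCompactSupport.of_support_subset_isCompact hc (support_gradient_subset φ))).restrict Ω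

/-- If `-div A + c = B` in the sense of distributions and `B ≤ 0` where `w > 0`, then `ramp w ^ 2`
is admissible as a test function in the inequality `-div A + c ≤ 0`, although `B` is only locally
integrable. -/
lemma energy_inequality {p q : ℝ≥0∞} [ENNReal.HolderTriple q p 1] (hΩ : IsOpen Ω)
    {A : EuclideanSpace ℝ (Fin N) → EuclideanSpace ℝ (Fin N)} {B c : EuclideanSpace ℝ (Fin N) → ℝ}
    (hA : MemLp A q (volume.restrict Ω)) (hG : MemLp G p (volume.restrict Ω))
    (hw : AEStronglyMeasurable w (volume.restrict Ω))
    (hφ : ∀ n, ContDiff ℝ 1 (φ n)) (hφc : ∀ n, HasCompactSupport (φ n))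
    (hφΩ : ∀ n, tsupport (φ n) ⊆ Ω)
    (hae : ∀ᵐ x ∂(volume.restrict Ω), Tendsto (fun n => φ n x) atTop (𝓝 (w x)))
    (hgrad : Tendsto (fun n => eLpNorm (fun x => gradient (φ n) x - G x) p (volume.restrict Ω))
      atTop (𝓝 0))
    (hc : IntegrableOn c Ω volume)
    (hB : ∀ K, IsCompact K → K ⊆ Ω → IntegrableOn B K volume)
    (hBw : ∀ᵐ x ∂(volume.restrict Ω), 0 < w x → B x ≤ 0)
    (heq : ∀ ψ : EuclideanSpace ℝ (Fin N) → ℝ, ContDiff ℝ 1 ψ → HasCompactSupport ψ →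
      tsupport ψ ⊆ Ω → (∫ x in Ω, inner ℝ (A x) (gradient ψ x)) + ∫ x in Ω, c x * ψ x
        = ∫ x in Ω, B x * ψ x) :
    (∫ x in Ω, inner ℝ (A x) ((rampDeriv (w x) * ramp (w x)) • G x))
      + (∫ x in Ω, inner ℝ (A x) ((ramp (w x) * rampDeriv (w x)) • G x))
      + ∫ x in Ω, c x * (ramp (w x) * ramp (w x)) ≤ 0 := by
  have hr : ∀ n, AEStronglyMeasurable (fun x => ramp (φ n x)) (volume.restrict Ω) := fun n =>
    (continuous_ramp.comp (hφ n).continuous).aestronglyMeasurable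
  have hr' : ∀ n, AEStronglyMeasurable (fun x => rampDeriv (φ n x)) (volume.restrict Ω) := fun n =>
    (continuous_rampDeriv.comp (hφ n).continuous).aestronglyMeasurable
  have hrw : AEStronglyMeasurable (fun x => ramp (w x)) (volume.restrict Ω) :=
    continuous_ramp.comp_aestronglyMeasurable hw
  have hrw' : AEStronglyMeasurable (fun x => rampDeriv (w x)) (volume.restrict Ω) :=
    continuous_rampDeriv.comp_aestronglyMeasurable hw
  have hlim : ∀ᵐ x ∂(volume.restrict Ω), Tendsto (fun n => ramp (φ n x)) atTop (𝓝 (ramp (w x))) :=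
    hae.mono fun x hx => (continuous_ramp.tendsto _).comp hx
  have hlim' : ∀ᵐ x ∂(volume.restrict Ω),
      Tendsto (fun n => rampDeriv (φ n x)) atTop (𝓝 (rampDeriv (w x))) :=
    hae.mono fun x hx => (continuous_rampDeriv.tendsto _).comp hx
  have hb : ∀ s t : ℝ, |ramp s * ramp t| ≤ 1 := fun s t => by
    rw [abs_mul]; exact mul_le_one₀ (abs_ramp_le s) (abs_nonneg _) (abs_ramp_le t)
  have hb1 : ∀ s t : ℝ, |rampDeriv s * ramp t| ≤ 1 := fun s t => by
    rw [abs_mul]; exact mul_le_one₀ (abs_rampDeriv_le s) (abs_nonneg _) (abs_ramp_le t)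
  have hb2 : ∀ s t : ℝ, |ramp s * rampDeriv t| ≤ 1 := fun s t => by
    rw [abs_mul]; exact mul_le_one₀ (abs_ramp_le s) (abs_nonneg _) (abs_rampDeriv_le t)
  have hLp : ∀ n, MemLp (gradient (φ n)) p (volume.restrict Ω) := fun n =>
    (hφ n).memLp_gradient (hφc n) p
  -- The test function `ramp (φ n) * ramp (φ k)`, after the limit in `k`, becomes
  -- `ramp (φ n) * ramp w`: it has compact support in `Ω` and lives where `B ≤ 0`.
  have hstep : ∀ n, (∫ x in Ω, inner ℝ (A x) ((rampDeriv (φ n x) * ramp (w x)) • gradient (φ n) x))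
      + (∫ x in Ω, inner ℝ (A x) ((ramp (φ n x) * rampDeriv (w x)) • G x))
      + ∫ x in Ω, c x * (ramp (φ n x) * ramp (w x)) ≤ 0 := by
    intro n
    have hS : tsupport (φ n) ⊆ Ω := hφΩ n
    have t1 := tendsto_integral_inner_smul hA (hLp n) (fun _ : ℕ => hLp n)
      (a := fun k x => rampDeriv (φ n x) * ramp (φ k x)) (fun k => (hr' n).mul (hr k))
      (fun k x => hb1 _ _) (hlim.mono fun x hx => hx.const_mul (rampDeriv (φ n x))) (by simp)
    have t2 := tendsto_integral_inner_smul hA hG hLp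
      (a := fun k x => ramp (φ n x) * rampDeriv (φ k x)) (fun k => (hr n).mul (hr' k))
      (fun k x => hb2 _ _) (hlim'.mono fun x hx => hx.const_mul (ramp (φ n x))) hgrad
    have t3 := tendsto_integral_mul_of_abs_le_one hc
      (a := fun k x => ramp (φ n x) * ramp (φ k x)) (fun k => (hr n).mul (hr k))
      (fun k x => hb _ _) (hlim.mono fun x hx => hx.const_mul (ramp (φ n x)))
    have hle : volume.restrict (tsupport (φ n)) ≤ volume.restrict Ω :=
      Measure.restrict_mono hS le_rfl
    have t4 := tendsto_integral_mul_of_abs_le_one (hB _ (hφc n) hS)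
      (a := fun k x => ramp (φ n x) * ramp (φ k x))
      (fun k => ((hr n).mul (hr k)).mono_measure hle)
      (fun k x => hb _ _) (ae_mono hle (hlim.mono fun x hx => hx.const_mul (ramp (φ n x))))
    have hsum : ∀ k,
        (∫ x in Ω, inner ℝ (A x) ((rampDeriv (φ n x) * ramp (φ k x)) • gradient (φ n) x))
        + (∫ x in Ω, inner ℝ (A x) ((ramp (φ n x) * rampDeriv (φ k x)) • gradient (φ k) x))
        + ∫ x in Ω, c x * (ramp (φ n x) * ramp (φ k x))
        = ∫ x in tsupport (φ n), B x * (ramp (φ n x) * ramp (φ k x)) := by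
      intro k
      have hts := tsupport_ramp_mul_ramp_subset (φ n) (φ k)
      have e := heq _ (contDiff_ramp_mul_ramp (hφ n) (hφ k)) ((hφc n).of_isClosed_subset
        (isClosed_tsupport _) hts) (hts.trans hS)
      have hz : ∀ x ∈ Ω \ tsupport (φ n), B x * (ramp (φ n x) * ramp (φ k x)) = 0 := fun x hx => by
        simp [image_eq_zero_of_notMem_tsupport hx.2, ramp_of_nonpos le_rfl]
      rw [setIntegral_eq_of_subset_of_forall_sdiff_eq_zero hΩ.measurableSet hS hz] at e
      rw [← e, ← integral_add
        (integrable_inner_smul (a := fun x => rampDeriv (φ n x) * ramp (φ k x)) hA (hLp n)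
          ((hr' n).mul (hr k)) fun x => hb1 _ _)
        (integrable_inner_smul (a := fun x => ramp (φ n x) * rampDeriv (φ k x)) hA (hLp k)
          ((hr n).mul (hr' k)) fun x => hb2 _ _)]
      simp_rw [gradient_ramp_mul_ramp ((hφ n).differentiable one_ne_zero)
        ((hφ k).differentiable one_ne_zero), inner_add_right]
    have hlimit := tendsto_nhds_unique (((t1.add t2).add t3).congr hsum) t4
    rw [hlimit]
    refine integral_nonpos_of_ae (ae_mono hle (hBw.mono fun x hx => ?_))
    rcases le_or_gt (w x) 0 with h0 | h0
    · simp [ramp_of_nonpos h0]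
    · exact mul_nonpos_of_nonpos_of_nonneg (hx h0) (mul_nonneg (ramp_nonneg _) (ramp_nonneg _))
  have t1 := tendsto_integral_inner_smul hA hG hLp
    (a := fun n x => rampDeriv (φ n x) * ramp (w x)) (fun n => (hr' n).mul hrw)
    (fun n x => hb1 _ _) (hlim'.mono fun x hx => hx.mul_const (ramp (w x))) hgrad
  have t2 := tendsto_integral_inner_smul hA hG (fun _ : ℕ => hG)
    (a := fun n x => ramp (φ n x) * rampDeriv (w x)) (fun n => (hr n).mul hrw')
    (fun n x => hb2 _ _) (hlim.mono fun x hx => hx.mul_const (rampDeriv (w x))) (by simp)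
  have t3 := tendsto_integral_mul_of_abs_le_one hc
    (a := fun n x => ramp (φ n x) * ramp (w x)) (fun n => (hr n).mul hrw)
    (fun n x => hb _ _) (hlim.mono fun x hx => hx.mul_const (ramp (w x)))
  exact le_of_tendsto' ((t1.add t2).add t3) hstep

/-- A function of `W^{1,1}_0(Ω)` whose gradient vanishes where the function is positive is
nonpositive: by the Gagliardo-Nirenberg-Sobolev inequality, `ramp (φ n) ^ 2` tends to `0` in `L^1`,
while it tends to `ramp w ^ 2` almost everywhere. -/
lemma ae_nonpos_of_gradient_eq_zero (hN : 1 < N) (hΩb : Bornology.IsBounded Ω)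
    (hw : AEStronglyMeasurable w (volume.restrict Ω))
    (hG : MemLp G 1 (volume.restrict Ω))
    (hφ : ∀ n, ContDiff ℝ 1 (φ n)) (hφc : ∀ n, HasCompactSupport (φ n))
    (hφΩ : ∀ n, tsupport (φ n) ⊆ Ω)
    (hae : ∀ᵐ x ∂(volume.restrict Ω), Tendsto (fun n => φ n x) atTop (𝓝 (w x)))
    (hgrad : Tendsto (fun n => eLpNorm (fun x => gradient (φ n) x - G x) 1 (volume.restrict Ω))
      atTop (𝓝 0))
    (hzero : ∀ᵐ x ∂(volume.restrict Ω), 0 < w x → G x = 0) :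
    ∀ᵐ x ∂(volume.restrict Ω), w x ≤ 0 := by
  set μ := volume.restrict Ω with hμ
  let a : ℕ → EuclideanSpace ℝ (Fin N) → ℝ := fun n x => rampDeriv (φ n x) * ramp (φ n x)
  have ham : ∀ n, AEStronglyMeasurable (a n) μ := fun n =>
    ((continuous_rampDeriv.comp (hφ n).continuous).mul
      (continuous_ramp.comp (hφ n).continuous)).aestronglyMeasurable
  have ha1 : ∀ n x, ‖a n x‖ₑ ≤ 1 := fun n x => by
    have : |a n x| ≤ 1 := by
      rw [abs_mul]
      exact mul_le_one₀ (abs_rampDeriv_le _) (abs_nonneg _) (abs_ramp_le _)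
    rw [Real.enorm_eq_ofReal_abs]
    exact ENNReal.ofReal_le_one.2 this
  have hLp : ∀ n, MemLp (gradient (φ n)) 1 μ := fun n => (hφ n).memLp_gradient (hφc n) 1
  let θ : ℕ → EuclideanSpace ℝ (Fin N) → ℝ := fun n x => ramp (φ n x) * ramp (φ n x)
  have hθ : ∀ n, ContDiff ℝ 1 (θ n) := fun n => contDiff_ramp_mul_ramp (hφ n) (hφ n)
  have hθs : ∀ n, tsupport (θ n) ⊆ Ω := fun n =>
    (tsupport_ramp_mul_ramp_subset (φ n) (φ n)).trans (hφΩ n)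
  have hgθ : ∀ n x, ‖gradient (θ n) x‖ₑ ≤
      2 * (‖gradient (φ n) x - G x‖ₑ + ‖a n x • G x‖ₑ) := by
    intro n x
    have e : gradient (θ n) x = (2 : ℝ) • (a n x • (gradient (φ n) x - G x) + a n x • G x) := by
      have := gradient_ramp_mul_ramp ((hφ n).differentiable one_ne_zero)
        ((hφ n).differentiable one_ne_zero) x
      rw [← smul_add, sub_add_cancel, this, mul_comm (ramp _), ← two_smul ℝ]
    have h2 : ‖(2 : ℝ)‖ₑ = 2 := by
      rw [Real.enorm_eq_ofReal_abs]; norm_num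
    rw [e, enorm_smul, h2]
    gcongr
    refine (enorm_add_le _ _).trans ?_
    gcongr
    rw [enorm_smul]
    exact mul_le_of_le_one_left' (ha1 n x)
  have hlim1 : Tendsto (fun n => ∫⁻ x, ‖gradient (φ n) x - G x‖ₑ ∂μ) atTop (𝓝 0) := by
    simpa only [eLpNorm_one_eq_lintegral_enorm] using hgrad
  have hlim2 : Tendsto (fun n => ∫⁻ x, ‖a n x • G x‖ₑ ∂μ) atTop (𝓝 0) := by
    have h0 : ∫⁻ _x : EuclideanSpace ℝ (Fin N), (0 : ℝ≥0∞) ∂μ = 0 := by simp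
    rw [← h0]
    refine tendsto_lintegral_of_dominated_convergence' (fun x => ‖G x‖ₑ)
      (fun n => ((ham n).smul hG.1).enorm) (fun n => Eventually.of_forall fun x => ?_) ?_ ?_
    · simp only [enorm_smul]
      exact mul_le_of_le_one_left' (ha1 n x)
    · rw [← eLpNorm_one_eq_lintegral_enorm]
      exact hG.2.ne
    · filter_upwards [hae, hzero] with x hx h0
      have h1 : Tendsto (fun n => a n x • G x) atTop
          (𝓝 ((rampDeriv (w x) * ramp (w x)) • G x)) :=
        (((continuous_rampDeriv.tendsto _).comp hx).mul
          ((continuous_ramp.tendsto _).comp hx)).smul_const _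
      have h2 : (rampDeriv (w x) * ramp (w x)) • G x = 0 := by
        rcases le_or_gt (w x) 0 with hw0 | hw0
        · simp [ramp_of_nonpos hw0]
        · simp [h0 hw0]
      rw [h2] at h1
      simpa using h1.enorm
  have hgθ0 : Tendsto (fun n => eLpNorm (gradient (θ n)) 1 μ) atTop (𝓝 0) := by
    have hsum := ENNReal.Tendsto.const_mul (a := 2) (hlim1.add hlim2) (Or.inr (by simp))
    rw [add_zero, mul_zero] at hsum
    have hdiff : ∀ n, AEMeasurable (fun x => ‖gradient (φ n) x - G x‖ₑ) μ := fun n =>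
      ((hLp n).1.sub hG.1).enorm
    refine tendsto_of_tendsto_of_tendsto_of_le_of_le tendsto_const_nhds hsum
      (fun _ => zero_le) fun n => ?_
    rw [eLpNorm_one_eq_lintegral_enorm]
    calc ∫⁻ x, ‖gradient (θ n) x‖ₑ ∂μ
        ≤ ∫⁻ x, 2 * (‖gradient (φ n) x - G x‖ₑ + ‖a n x • G x‖ₑ) ∂μ := lintegral_mono (hgθ n)
      _ = 2 * (∫⁻ x, ‖gradient (φ n) x - G x‖ₑ ∂μ + ∫⁻ x, ‖a n x • G x‖ₑ ∂μ) := by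
          rw [lintegral_const_mul' _ _ (by simp),
            lintegral_add_left' (hdiff n)]
  have hθ0 : Tendsto (fun n => eLpNorm (θ n) 1 μ) atTop (𝓝 0) := by
    let C : ℝ≥0 := eLpNormLESNormFDerivOfLeConst ℝ
      (volume : Measure (EuclideanSpace ℝ (Fin N))) Ω 1 1
    have hC := ENNReal.Tendsto.const_mul (a := C) hgθ0 (Or.inr ENNReal.coe_ne_top)
    rw [mul_zero] at hC
    refine tendsto_of_tendsto_of_tendsto_of_le_of_le tendsto_const_nhds hC
      (fun _ => zero_le) fun n => ?_
    have hs := eLpNorm_le_eLpNorm_fderiv (volume : Measure (EuclideanSpace ℝ (Fin N))) (hθ n)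
      ((subset_tsupport _).trans (hθs n)) (p := 1) le_rfl (by simpa using hN) hΩb
    have e : eLpNorm (fderiv ℝ (θ n)) 1 volume = eLpNorm (gradient (θ n)) 1 μ := by
      rw [hμ, eLpNorm_restrict_eq_of_support_subset
        ((support_gradient_subset (θ n)).trans (hθs n))]
      exact eLpNorm_congr_norm_ae (Eventually.of_forall fun x => by simp [gradient])
    rw [ENNReal.coe_one, e] at hs
    exact (eLpNorm_mono_measure _ Measure.restrict_le_self).trans hs
  have hθlim : ∀ᵐ x ∂μ, Tendsto (fun n => θ n x) atTop (𝓝 (ramp (w x) * ramp (w x))) :=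
    hae.mono fun x hx => ((continuous_ramp.tendsto _).comp hx).mul
      ((continuous_ramp.tendsto _).comp hx)
  have hfatou := Lp.eLpNorm_lim_le_liminf_eLpNorm (p := 1) (μ := μ)
    (fun n => (hθ n).continuous.aestronglyMeasurable) _ hθlim
  have hm : AEStronglyMeasurable (fun x => ramp (w x) * ramp (w x)) μ :=
    (continuous_ramp.comp_aestronglyMeasurable hw).mul
      (continuous_ramp.comp_aestronglyMeasurable hw)
  rw [hθ0.liminf_eq, nonpos_iff_eq_zero, eLpNorm_eq_zero_iff hm one_ne_zero] at hfatou
  filter_upwards [hfatou] with x hx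
  by_contra! hpos
  exact (mul_pos (ramp_pos hpos) (ramp_pos hpos)).ne' hx

end Energy

/-! ### Comparison of two finite-energy solutions -/

section Comparison

variable {N : ℕ} {Ω : Set (EuclideanSpace ℝ (Fin N))}

lemma integrable_smul_of_integrableOn_tsupport {F : Type*} [NormedAddCommGroup F] [NormedSpace ℝ F]
    {φ : EuclideanSpace ℝ (Fin N) → ℝ} (hφ : Continuous φ) (hφc : HasCompactSupport φ)
    {v : EuclideanSpace ℝ (Fin N) → F} (hv : IntegrableOn v (tsupport φ) volume) :
    Integrable (fun x => φ x • v x) volume := by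
  obtain ⟨C, hC⟩ := hφ.bounded_above_of_compact_support hφc
  have h : IntegrableOn (fun x => φ x • v x) (tsupport φ) volume :=
    hv.bdd_smul C hφ.aestronglyMeasurable (Eventually.of_forall hC)
  refine (integrableOn_iff_integrable_of_support_subset fun x hx => ?_).1 h
  exact subset_tsupport φ fun h0 => hx (by simp [h0])

lemma IsWeakGradient.ae_eq (hΩ : IsOpen Ω) {u : EuclideanSpace ℝ (Fin N) → ℝ}
    {G H : EuclideanSpace ℝ (Fin N) → EuclideanSpace ℝ (Fin N)}
    (hG : IsWeakGradient Ω u G) (hH : IsWeakGradient Ω u H) : G =ᵐ[volume.restrict Ω] H := by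
  have h := hΩ.ae_eq_zero_of_integral_contDiff_smul_eq_zero
    (hG.locallyIntegrable_grad.sub hH.locallyIntegrable_grad) fun φ hφ hφc hφΩ => by
      have hint : ∀ K : EuclideanSpace ℝ (Fin N) → EuclideanSpace ℝ (Fin N),
          LocallyIntegrableOn K Ω volume → Integrable (fun x => φ x • K x) volume := fun K hK =>
        integrable_smul_of_integrableOn_tsupport hφ.continuous hφc
          (hK.integrableOn_compact_subset hφΩ hφc)
      have hset : ∀ K : EuclideanSpace ℝ (Fin N) → EuclideanSpace ℝ (Fin N),
          ∫ x, φ x • K x = ∫ x in Ω, φ x • K x := fun K =>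
        (setIntegral_eq_integral_of_forall_compl_eq_zero fun x hx => by
          simp [image_eq_zero_of_notMem_tsupport fun h => hx (hφΩ h)]).symm
      simp only [Pi.sub_apply, smul_sub]
      rw [integral_sub (hint G hG.locallyIntegrable_grad) (hint H hH.locallyIntegrable_grad),
        hset, hset, sub_eq_zero, ← neg_inj, ← hG.integral_eq φ hφ hφc hφΩ,
        ← hH.integral_eq φ hφ hφc hφΩ]
  filter_upwards [ae_restrict_of_ae h, ae_restrict_mem hΩ.measurableSet] with x hx hxΩ
  exact sub_eq_zero.1 (hx hxΩ)

lemma aemeasurable_singularTerm {h : ℝ≥0 → ℝ≥0∞} (h_cont : Continuous h)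
    {f u : EuclideanSpace ℝ (Fin N) → ℝ} (hf : AEMeasurable f (volume.restrict Ω))
    (hu : AEMeasurable u (volume.restrict Ω)) :
    AEMeasurable (singularTerm h f u) (volume.restrict Ω) :=
  (h_cont.measurable.comp_aemeasurable hu.real_toNNReal).mul hf.ennreal_ofReal

/-- Where `u₂ ≤ u₁`, the function `h(u₁) f` is at most `h(u₂) f`. Finiteness of the latter is needed
for the real values to compare, as `⊤.toReal = 0`. -/
lemma toReal_singularTerm_le {h : ℝ≥0 → ℝ≥0∞} (h_anti : Antitone h)
    {f u₁ u₂ : EuclideanSpace ℝ (Fin N) → ℝ} {x : EuclideanSpace ℝ (Fin N)}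
    (hx : singularTerm h f u₂ x ≠ ⊤) (hle : u₂ x ≤ u₁ x) :
    (singularTerm h f u₁ x).toReal ≤ (singularTerm h f u₂ x).toReal := by
  refine ENNReal.toReal_mono hx ?_
  unfold singularTerm
  gcongr
  exact h_anti (Real.toNNReal_le_toNNReal hle)

lemma ae_restrict_of_forall_isCompact (hΩ : IsOpen Ω)
    {P : EuclideanSpace ℝ (Fin N) → Prop}
    (h : ∀ K, IsCompact K → K ⊆ Ω → ∀ᵐ x ∂(volume.restrict K), P x) :
    ∀ᵐ x ∂(volume.restrict Ω), P x := by
  have : LocallyCompactSpace Ω := hΩ.locallyCompactSpace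
  obtain ⟨K, hK, hKΩ⟩ : IsSigmaCompact Ω := isSigmaCompact_iff_sigmaCompactSpace.2 inferInstance
  rw [← hKΩ, ae_restrict_iUnion_iff]
  exact fun n => h (K n) (hK n) (hKΩ ▸ subset_iUnion K n)

/-- One-sided comparison: test the difference of the two equations with `ramp (u₁ - u₂) ^ 2`. The
right-hand side is nonpositive by monotonicity of `h`, and the absorption term and the principal
part are nonnegative. -/
theorem ae_le_of_isDistributionalSolution (p : ℝ) (hp : 1 < p) (hpN : p < N)
    (hΩ : IsOpen Ω) (hΩb : Bornology.IsBounded Ω)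
    {f : EuclideanSpace ℝ (Fin N) → ℝ} (hf : AEMeasurable f (volume.restrict Ω))
    {h : ℝ≥0 → ℝ≥0∞} (h_cont : Continuous h) (h_anti : Antitone h)
    {g : ℝ≥0 → ℝ≥0} (g_mono : Monotone g)
    {u₁ u₂ : EuclideanSpace ℝ (Fin N) → ℝ}
    (hu₁ : IsDistributionalSolution p Ω g h f u₁)
    (hu₁_energy : MemW1Zero (ENNReal.ofReal p) Ω u₁)
    (hu₁_int : IntegrableOn (fun x => (g (u₁ x).toNNReal : ℝ)) Ω volume)
    (hu₂ : IsDistributionalSolution p Ω g h f u₂)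
    (hu₂_energy : MemW1Zero (ENNReal.ofReal p) Ω u₂)
    (hu₂_int : IntegrableOn (fun x => (g (u₂ x).toNNReal : ℝ)) Ω volume) :
    u₁ ≤ᵐ[volume.restrict Ω] u₂ := by
  have hfin : IsFiniteMeasure (volume.restrict Ω) := ⟨by
    simpa using hΩb.measure_lt_top⟩
  have hp1 : (1 : ℝ≥0∞) ≤ ENNReal.ofReal p := ENNReal.one_le_ofReal.2 hp.le
  have hp0 : ENNReal.ofReal p ≠ 0 := (zero_lt_one.trans_le hp1).ne'
  have hN : 1 < N := by exact_mod_cast hp.trans hpN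
  have : ENNReal.HolderTriple (ENNReal.ofReal (p / (p - 1))) (ENNReal.ofReal p) 1 :=
    ((Real.HolderConjugate.conjExponent hp).symm.ennrealOfReal :
      ENNReal.HolderConjugate (ENNReal.ofReal (Real.conjExponent p)) (ENNReal.ofReal p))
  obtain ⟨G₁, hG₁w, hu₁L, hG₁, φ₁, hφ₁, hφ₁u, hφ₁G⟩ := hu₁_energy
  obtain ⟨G₂, hG₂w, hu₂L, hG₂, φ₂, hφ₂, hφ₂u, hφ₂G⟩ := hu₂_energy
  obtain ⟨H₁, hH₁w, -, heq₁⟩ := hu₁.weak_formulation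
  obtain ⟨H₂, hH₂w, -, heq₂⟩ := hu₂.weak_formulation
  have hGH₁ := hG₁w.ae_eq hΩ hH₁w
  have hGH₂ := hG₂w.ae_eq hΩ hH₂w
  -- The approximations of `u₁` and `u₂` give one of `w = u₁ - u₂`.
  let w : EuclideanSpace ℝ (Fin N) → ℝ := fun x => u₁ x - u₂ x
  let G : EuclideanSpace ℝ (Fin N) → EuclideanSpace ℝ (Fin N) := fun x => G₁ x - G₂ x
  let A : EuclideanSpace ℝ (Fin N) → EuclideanSpace ℝ (Fin N) := fun x =>
    ‖G₁ x‖ ^ (p - 2) • G₁ x - ‖G₂ x‖ ^ (p - 2) • G₂ x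
  let c : EuclideanSpace ℝ (Fin N) → ℝ := fun x =>
    (g (u₁ x).toNNReal : ℝ) - (g (u₂ x).toNNReal : ℝ)
  let B : EuclideanSpace ℝ (Fin N) → ℝ := fun x =>
    (singularTerm h f u₁ x).toReal - (singularTerm h f u₂ x).toReal
  let φ : ℕ → EuclideanSpace ℝ (Fin N) → ℝ := fun n x => φ₁ n x - φ₂ n x
  have hφ : ∀ n, ContDiff ℝ 1 (φ n) := fun n =>
    ((hφ₁ n).1.sub (hφ₂ n).1).of_le (by simp)
  have hφc : ∀ n, HasCompactSupport (φ n) := fun n => (hφ₁ n).2.1.sub (hφ₂ n).2.1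
  have hφΩ : ∀ n, tsupport (φ n) ⊆ Ω := fun n =>
    (tsupport_sub (φ₁ n) (φ₂ n)).trans (union_subset (hφ₁ n).2.2 (hφ₂ n).2.2)
  have hw : MemLp w (ENNReal.ofReal p) (volume.restrict Ω) := hu₁L.sub hu₂L
  have hG : MemLp G (ENNReal.ofReal p) (volume.restrict Ω) := hG₁.sub hG₂
  have hA : MemLp A (ENNReal.ofReal (p / (p - 1))) (volume.restrict Ω) :=
    (hG₁.rpow_norm_smul hp).sub (hG₂.rpow_norm_smul hp)
  have hφw : Tendsto (fun n => eLpNorm (φ n - w) (ENNReal.ofReal p) (volume.restrict Ω)) atTop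
      (𝓝 0) := by
    have hsum := hφ₁u.add hφ₂u
    rw [add_zero] at hsum
    refine tendsto_of_tendsto_of_tendsto_of_le_of_le tendsto_const_nhds hsum
      (fun _ => zero_le) fun n => ?_
    have e : φ n - w = (fun x => φ₁ n x - u₁ x) - fun x => φ₂ n x - u₂ x := by
      ext x; simp only [φ, w, Pi.sub_apply]; ring
    rw [e]
    exact eLpNorm_sub_le ((hφ₁ n).1.continuous.aestronglyMeasurable.sub hu₁L.1)
      ((hφ₂ n).1.continuous.aestronglyMeasurable.sub hu₂L.1) hp1
  have hφG : Tendsto (fun n => eLpNorm (fun x => gradient (φ n) x - G x) (ENNReal.ofReal p)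
      (volume.restrict Ω)) atTop (𝓝 0) := by
    have hsum := hφ₁G.add hφ₂G
    rw [add_zero] at hsum
    refine tendsto_of_tendsto_of_tendsto_of_le_of_le tendsto_const_nhds hsum
      (fun _ => zero_le) fun n => ?_
    have h1 : ContDiff ℝ 1 (φ₁ n) := (hφ₁ n).1.of_le (by simp)
    have h2 : ContDiff ℝ 1 (φ₂ n) := (hφ₂ n).1.of_le (by simp)
    have e : (fun x => gradient (φ n) x - G x) =
        (fun x => gradient (φ₁ n) x - G₁ x) - fun x => gradient (φ₂ n) x - G₂ x := by
      ext1 x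
      have hg : gradient (φ n) x = gradient (φ₁ n) x - gradient (φ₂ n) x := by
        simp only [gradient, φ]
        rw [fderiv_fun_sub (h1.differentiable one_ne_zero x) (h2.differentiable one_ne_zero x),
          map_sub]
      simp only [hg, G, Pi.sub_apply]
      abel
    rw [e]
    exact eLpNorm_sub_le (h1.continuous_gradient.aestronglyMeasurable.sub hG₁.1)
      (h2.continuous_gradient.aestronglyMeasurable.sub hG₂.1) hp1
  obtain ⟨ns, hns, hae⟩ := (tendstoInMeasure_of_tendsto_eLpNorm hp0
    (fun n => (hφ n).continuous.aestronglyMeasurable) hw.1 hφw).exists_seq_tendsto_ae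
  have hφG' := hφG.comp hns.tendsto_atTop
  -- The equation satisfied by the difference.
  have hBint : ∀ {u : EuclideanSpace ℝ (Fin N) → ℝ}, IsDistributionalSolution p Ω g h f u →
      AEMeasurable u (volume.restrict Ω) → ∀ K, IsCompact K → K ⊆ Ω →
      IntegrableOn (fun x => (singularTerm h f u x).toReal) K volume := fun hu hum K hK hKΩ =>
    integrable_toReal_of_lintegral_ne_top
      ((aemeasurable_singularTerm h_cont hf hum).mono_measure (Measure.restrict_mono hKΩ le_rfl))
      (hu.singular_locallyIntegrable K hK hKΩ).ne
  have hB₁ := hBint hu₁ hu₁L.1.aemeasurable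
  have hB₂ := hBint hu₂ hu₂L.1.aemeasurable
  have hsing₂ : ∀ᵐ x ∂(volume.restrict Ω), singularTerm h f u₂ x ≠ ⊤ :=
    ae_restrict_of_forall_isCompact hΩ fun K hK hKΩ =>
      (ae_lt_top' ((aemeasurable_singularTerm h_cont hf hu₂L.1.aemeasurable).mono_measure
        (Measure.restrict_mono hKΩ le_rfl))
        (hu₂.singular_locallyIntegrable K hK hKΩ).ne).mono fun x hx => hx.ne
  have heq : ∀ ψ : EuclideanSpace ℝ (Fin N) → ℝ, ContDiff ℝ 1 ψ → HasCompactSupport ψ →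
      tsupport ψ ⊆ Ω → (∫ x in Ω, inner ℝ (A x) (gradient ψ x)) + ∫ x in Ω, c x * ψ x
        = ∫ x in Ω, B x * ψ x := by
    intro ψ hψ hψc hψΩ
    have e₁ := heq₁ ψ hψ hψc hψΩ
    have e₂ := heq₂ ψ hψ hψc hψΩ
    have i₁ : ∀ {G' : EuclideanSpace ℝ (Fin N) → EuclideanSpace ℝ (Fin N)},
        MemLp G' (ENNReal.ofReal p) (volume.restrict Ω) →
        IntegrableOn (fun x => inner ℝ (‖G' x‖ ^ (p - 2) • G' x) (gradient ψ x)) Ω volume :=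
      fun hG' => by
        have := integrable_inner_smul (a := fun _ => 1) (hG'.rpow_norm_smul hp)
          (hψ.memLp_gradient hψc (ENNReal.ofReal p)) aestronglyMeasurable_const (by simp)
        simpa only [one_smul, IntegrableOn] using this
    have i₂ : ∀ {v : EuclideanSpace ℝ (Fin N) → ℝ}, IntegrableOn v (tsupport ψ) volume →
        IntegrableOn (fun x => v x * ψ x) Ω volume := fun {v} hv => by
      simpa only [smul_eq_mul, mul_comm] using
        (integrable_smul_of_integrableOn_tsupport hψ.continuous hψc hv).integrableOn (s := Ω)
    have hH₁ : ∫ x in Ω, inner ℝ (‖H₁ x‖ ^ (p - 2) • H₁ x) (gradient ψ x) =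
        ∫ x in Ω, inner ℝ (‖G₁ x‖ ^ (p - 2) • G₁ x) (gradient ψ x) :=
      integral_congr_ae (hGH₁.mono fun x hx => by simp only [hx])
    have hH₂ : ∫ x in Ω, inner ℝ (‖H₂ x‖ ^ (p - 2) • H₂ x) (gradient ψ x) =
        ∫ x in Ω, inner ℝ (‖G₂ x‖ ^ (p - 2) • G₂ x) (gradient ψ x) :=
      integral_congr_ae (hGH₂.mono fun x hx => by simp only [hx])
    rw [hH₁] at e₁
    rw [hH₂] at e₂
    simp only [A, B, c, inner_sub_left, sub_mul]
    rw [integral_sub (i₁ hG₁) (i₁ hG₂), integral_sub (i₂ (hu₁_int.mono_set hψΩ))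
      (i₂ (hu₂_int.mono_set hψΩ)), integral_sub (i₂ (hB₁ _ hψc hψΩ)) (i₂ (hB₂ _ hψc hψΩ))]
    linarith
  have hBw : ∀ᵐ x ∂(volume.restrict Ω), 0 < w x → B x ≤ 0 := hsing₂.mono fun x hx hwx =>
    sub_nonpos.2 (toReal_singularTerm_le h_anti hx (sub_pos.1 hwx).le)
  have hE := energy_inequality (B := B) (c := c) hΩ hA hG hw.1 (fun n => hφ (ns n))
    (fun n => hφc (ns n)) (fun n => hφΩ (ns n)) hae hφG' (hu₁_int.sub hu₂_int)
    (fun K hK hKΩ => (hB₁ K hK hKΩ).sub (hB₂ K hK hKΩ)) hBw heq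
  -- All three integrands in the energy inequality are nonnegative, hence the first one vanishes.
  have hmono : ∀ x, 0 ≤ inner ℝ (A x) (G x) := fun x => inner_rpow_smul_sub_nonneg hp _ _
  have n₁ : ∀ x, 0 ≤ inner ℝ (A x) ((rampDeriv (w x) * ramp (w x)) • G x) := fun x => by
    rw [inner_smul_right]
    exact mul_nonneg (mul_nonneg (rampDeriv_nonneg _) (ramp_nonneg _)) (hmono x)
  have n₂ : ∀ x, 0 ≤ inner ℝ (A x) ((ramp (w x) * rampDeriv (w x)) • G x) := fun x => by
    rw [inner_smul_right]
    exact mul_nonneg (mul_nonneg (ramp_nonneg _) (rampDeriv_nonneg _)) (hmono x)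
  have n₃ : ∀ x, 0 ≤ c x * (ramp (w x) * ramp (w x)) := fun x => by
    rcases le_or_gt (w x) 0 with h0 | h0
    · simp [ramp_of_nonpos h0]
    · have hg : g (u₂ x).toNNReal ≤ g (u₁ x).toNNReal :=
        g_mono (Real.toNNReal_le_toNNReal (sub_pos.1 h0).le)
      exact mul_nonneg (sub_nonneg.2 (by exact_mod_cast hg))
        (mul_nonneg (ramp_nonneg _) (ramp_nonneg _))
  have hzero : ∫ x in Ω, inner ℝ (A x) ((rampDeriv (w x) * ramp (w x)) • G x) = 0 := by
    have := setIntegral_nonneg (μ := volume) hΩ.measurableSet fun x _ => n₁ x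
    have := setIntegral_nonneg (μ := volume) hΩ.measurableSet fun x _ => n₂ x
    have := setIntegral_nonneg (μ := volume) hΩ.measurableSet fun x _ => n₃ x
    linarith
  have hint : Integrable (fun x => inner ℝ (A x) ((rampDeriv (w x) * ramp (w x)) • G x))
      (volume.restrict Ω) :=
    integrable_inner_smul hA hG
      ((continuous_rampDeriv.mul continuous_ramp).comp_aestronglyMeasurable hw.1) fun x => by
        rw [abs_mul]
        exact mul_le_one₀ (abs_rampDeriv_le _) (abs_nonneg _) (abs_ramp_le _)
  have hG0 : ∀ᵐ x ∂(volume.restrict Ω), 0 < w x → G x = 0 := by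
    filter_upwards [(integral_eq_zero_iff_of_nonneg n₁ hint).1 hzero] with x hx hwx
    by_contra hne
    have hpos : 0 < inner ℝ (A x) (G x) := inner_rpow_smul_sub_pos hp (sub_ne_zero.1 hne)
    have := mul_pos (mul_pos (rampDeriv_pos hwx) (ramp_pos hwx)) hpos
    rw [← inner_smul_right] at this
    exact this.ne' hx
  have hφG1 : Tendsto (fun n => eLpNorm (fun x => gradient (φ (ns n)) x - G x) 1
      (volume.restrict Ω)) atTop (𝓝 0) := by
    have hlim := ENNReal.Tendsto.mul_const (b := volume.restrict Ω univ ^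
      (1 / (1 : ℝ≥0∞).toReal - 1 / (ENNReal.ofReal p).toReal)) hφG' (Or.inr ?_)
    · rw [zero_mul] at hlim
      exact tendsto_of_tendsto_of_tendsto_of_le_of_le tendsto_const_nhds hlim
        (fun _ => zero_le) fun n => eLpNorm_le_eLpNorm_mul_rpow_measure_univ hp1
          ((hφ (ns n)).continuous_gradient.aestronglyMeasurable.sub hG.1)
    · refine ENNReal.rpow_ne_top_of_nonneg ?_ (measure_ne_top _ _)
      rw [ENNReal.toReal_ofReal (by linarith), ENNReal.toReal_one, one_div_one, sub_nonneg,
        div_le_one (by linarith)]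
      exact hp.le
  filter_upwards [ae_nonpos_of_gradient_eq_zero hN hΩb hw.1 (hG.mono_exponent hp1)
    (fun n => hφ (ns n)) (fun n => hφc (ns n)) (fun n => hφΩ (ns n)) hae hφG1 hG0] with x hx
  exact sub_nonpos.1 hx

end Comparison

theorem mainTheorem5 {N : ℕ} (p : ℝ) (hp : 1 < p) (hpN : p < N)
    (Ω : Set (EuclideanSpace ℝ (Fin N))) (hΩ : IsOpen Ω) (hΩb : Bornology.IsBounded Ω)
    (m : ℝ≥0∞) (hm : 1 ≤ m)
    (f : EuclideanSpace ℝ (Fin N) → ℝ) (hf : MemLp f m (volume.restrict Ω))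
    (hf_nonneg : ∀ᵐ x ∂(volume.restrict Ω), 0 ≤ f x)
    (h : ℝ≥0 → ℝ≥0∞) (h_cont : Continuous h) (h_zero : h 0 ≠ 0)
    (h_finite : ∀ s : ℝ≥0, s ≠ 0 → h s ≠ ⊤) (h_anti : Antitone h)
    (g : ℝ≥0 → ℝ≥0) (g_cont : Continuous g) (g_zero : g 0 = 0) (g_mono : Monotone g)
    (u₁ u₂ : EuclideanSpace ℝ (Fin N) → ℝ)
    (hu₁ : IsDistributionalSolution p Ω g h f u₁)
    (hu₁_energy : MemW1Zero (ENNReal.ofReal p) Ω u₁)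
    (hu₁_int : IntegrableOn (fun x => (g (u₁ x).toNNReal : ℝ)) Ω volume)
    (hu₂ : IsDistributionalSolution p Ω g h f u₂)
    (hu₂_energy : MemW1Zero (ENNReal.ofReal p) Ω u₂)
    (hu₂_int : IntegrableOn (fun x => (g (u₂ x).toNNReal : ℝ)) Ω volume) :
    u₁ =ᵐ[volume.restrict Ω] u₂ :=
  (ae_le_of_isDistributionalSolution p hp hpN hΩ hΩb hf.1.aemeasurable h_cont h_anti g_mono
    hu₁ hu₁_energy hu₁_int hu₂ hu₂_energy hu₂_int).antisymm
  (ae_le_of_isDistributionalSolution p hp hpN hΩ hΩb hf.1.aemeasurable h_cont h_anti g_mono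
    hu₂ hu₂_energy hu₂_int hu₁ hu₁_energy hu₁_int)
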